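/- Let $\mathcal H$ be a separable complex Hilbert space and $1<p<\infty$. For a bounded operator $A$ on $\mathcal H$ put $|A|=(A^*A)^{1/2}$, and let $A=U|A|$ be its polar decomposition ($U$ a partial isometry with $\ker U=\ker A$). Write $\operatorname{tr}T=\sum_j\langle Te_j,e_j\rangle$ for the trace, where $(e_j)$ is an orthonormal basis of $\mathcal H$; the trace exists when this series converges unconditionally, with the same sum, for every orthonormal basis. Let $\mathbb B_p(\mathcal H)$ be the Schatten class of all compact operators $A$ on $\mathcal H$ with $\|A\|_p:=(\operatorname{tr}|A|^p)^{1/p}<\infty$. For $A,B\in\mathbb B_p(\mathcal H)$ put $$[B,A]=\|A\|_p^{2-p}\,\operatorname{tr}\bigl(|A|^{p-1}U^*B\bigr),$$ understood as $[B,0]=0$ for $A=0$. The trace on the right always exists, and $\bigl(\mathbb B_p(\mathcal H),[\cdot,\cdot]\bigr)$ is a continuous semi-inner product space, that is, $\mathbb B_p(\mathcal H)$ is a complex vector space normed by $\|\cdot\|_p$, and for all $A,B,C\in\mathbb B_p(\mathcal H)$ and $\alpha,\beta,\gamma\in\mathbb C$: 1. $[A,A]=\|A\|_p^2$; 2. $[\alpha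 A+\beta B,C]=\alpha[A,C]+\beta[B,C]$; 3. $[A,\gamma B]=\overline{\gamma}\,[A,B]$; 4. $|[A,B]|^2\le\|A\|_p^2\,\|B\|_p^2$; 5. (continuity) if $\|A\|_p=\|B\|_p=1$, then $\operatorname{Re}[B,A+rB]\to\operatorname{Re}[B,A]$ as $r\to0$, $r\in\mathbb R$. Moreover, for all $A,B\in\mathbb B_p(\mathcal H)$ the following are equivalent: (i) $A\perp_{BJ}^pB$, that is, $\|A\|_p\le\|A+\gamma B\|_p$ for all $\gamma\in\mathbb C$; (ii) $[B,A]=0$. -/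

import Mathlib

open scoped ComplexConjugate InnerProductSpace

universe u

namespace Schatten

noncomputable section

section Trace

variable {H : Type u} [NormedAddCommGroup H] [InnerProductSpace ℂ H] [CompleteSpace H]

/-- `T` has trace `t`: for every orthonormal (Hilbert) basis `(e i)` of `H` the series
`∑ i, ⟨T e i, e i⟩` converges unconditionally, with sum `t`. Mathlib's inner product is conjugate
linear in its first argument, so `⟨T e, e⟩` is written `⟪e, T e⟫_ℂ`. -/
def HasTrace (T : H →L[ℂ] H) (t : ℂ) : Prop :=
  ∀ (ι : Type u) (e : HilbertBasis ι ℂ H), HasSum (fun i => ⟪e i, T (e i)⟫_ℂ) t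

open Classical in
/-- The trace functional (with value `0` where the trace does not exist). -/
def tr (T : H →L[ℂ] H) : ℂ := if h : ∃ t, HasTrace T t then h.choose else 0

theorem HasTrace.unique {T : H →L[ℂ] H} {s t : ℂ} (hs : HasTrace T s) (ht : HasTrace T t) :
    s = t := by
  obtain ⟨w, e, -⟩ := exists_hilbertBasis ℂ H
  exact (hs w e).unique (ht w e)

theorem HasTrace.tr_eq {T : H →L[ℂ] H} {t : ℂ} (h : HasTrace T t) : tr T = t := by
  have h' : ∃ t, HasTrace T t := ⟨t, h⟩
  rw [tr, dif_pos h']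
  exact h'.choose_spec.unique h

/-- The Schatten class `𝔹_p(H)`: the compact operators `A` for which `tr |A|^p` is finite, where
`|A| = (A* A)^(1/2)`. -/
def schattenClass (H : Type u) [NormedAddCommGroup H] [InnerProductSpace ℂ H] [CompleteSpace H]
    (p : ℝ) : Set (H →L[ℂ] H) :=
  {A | IsCompactOperator A ∧ ∃ t, HasTrace (CFC.abs A ^ p) t}

/-- The Schatten norm `‖A‖_p = (tr |A|^p)^(1/p)`. -/
def pNorm (p : ℝ) (A : H →L[ℂ] H) : ℝ := (tr (CFC.abs A ^ p)).re ^ (1 / p)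

end Trace

section Polar

variable {H : Type u} [NormedAddCommGroup H] [InnerProductSpace ℂ H] [CompleteSpace H]

/-- `A = U |A|` is the polar decomposition of `A`: `U` is a partial isometry (that is, isometric
on the orthogonal complement of its kernel) with the same kernel as `A`. -/
structure IsPolarDecomposition (A U : H →L[ℂ] H) : Prop where
  eq_mul_abs : A = U * CFC.abs A
  ker_eq : ∀ x, U x = 0 ↔ A x = 0
  isometric : ∀ x, (∀ y, U y = 0 → ⟪y, x⟫_ℂ = 0) → ‖U x‖ = ‖x‖

theorem norm_abs_apply (A : H →L[ℂ] H) (x : H) : ‖CFC.abs A x‖ = ‖A x‖ := by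
  have hsa : star (CFC.abs A) = CFC.abs A := (CFC.abs_nonneg A).isSelfAdjoint
  have h1 : ⟪CFC.abs A x, CFC.abs A x⟫_ℂ = ⟪A x, A x⟫_ℂ := by
    rw [← ContinuousLinearMap.adjoint_inner_right, ← ContinuousLinearMap.adjoint_inner_right A,
      ← ContinuousLinearMap.star_eq_adjoint, ← ContinuousLinearMap.star_eq_adjoint, hsa]
    have := congrArg (fun T : H →L[ℂ] H => T x) (CFC.abs_mul_abs A)
    simp only [mul_apply_eq_comp] at this
    rw [this]
  rw [inner_self_eq_norm_sq_to_K, inner_self_eq_norm_sq_to_K] at h1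
  have h2 : ‖CFC.abs A x‖ ^ 2 = ‖A x‖ ^ 2 := by exact_mod_cast h1
  exact (pow_left_inj₀ (norm_nonneg _) (norm_nonneg _) two_ne_zero).1 h2

theorem abs_inner (A : H →L[ℂ] H) (x y : H) : ⟪CFC.abs A x, y⟫_ℂ = ⟪x, CFC.abs A y⟫_ℂ := by
  have hsa : star (CFC.abs A) = CFC.abs A := (CFC.abs_nonneg A).isSelfAdjoint
  rw [← ContinuousLinearMap.adjoint_inner_right, ← ContinuousLinearMap.star_eq_adjoint, hsa]

/-- A vector orthogonal to `ker A` lies in the closure of the range of `|A|`. -/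
theorem mem_closure_range_abs (A : H →L[ℂ] H) (x : H) (hx : ∀ y, A y = 0 → ⟪y, x⟫_ℂ = 0) :
    x ∈ (CFC.abs A).range.topologicalClosure := by
  rw [← Submodule.orthogonal_orthogonal_eq_closure, Submodule.mem_orthogonal]
  intro y hy
  apply hx
  rw [← norm_eq_zero, ← norm_abs_apply, norm_eq_zero]
  rw [Submodule.mem_orthogonal] at hy
  have := hy (CFC.abs A (CFC.abs A y)) ⟨_, rfl⟩
  rw [abs_inner] at this
  exact inner_self_eq_zero.1 this

theorem exists_isPolarDecomposition (A : H →L[ℂ] H) : ∃ U, IsPolarDecomposition A U := by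
  set K := (CFC.abs A).range.topologicalClosure with hK
  have : CompleteSpace K := (Submodule.isClosed_topologicalClosure _).completeSpace_coe
  have hmem : ∀ x, CFC.abs A x ∈ K := fun x =>
    Submodule.le_topologicalClosure _ ⟨x, rfl⟩
  let e : H →ₗ[ℂ] K := (CFC.abs A).toLinearMap.codRestrict K hmem
  have he : ∀ x, ((e x : K) : H) = CFC.abs A x := fun x => rfl
  have hnorm : ∀ x, ‖A.toLinearMap x‖ = ‖e x‖ := fun x => (norm_abs_apply A x).symm
  have hd : DenseRange e := by
    intro k
    have hk : (k : H) ∈ closure (Set.range ⇑(CFC.abs A : H →L[ℂ] H)) := k.2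
    rw [closure_subtype]
    convert hk using 2
    ext z
    constructor
    · rintro ⟨_, ⟨x, rfl⟩, rfl⟩
      exact ⟨x, rfl⟩
    · rintro ⟨x, rfl⟩
      exact ⟨e x, ⟨x, rfl⟩, rfl⟩
  let V : K →L[ℂ] H := A.toLinearMap.extendOfNorm e
  have hV : ∀ x, V (e x) = A x := fun x =>
    LinearMap.extendOfNorm_eq hd ⟨1, fun y => by rw [one_mul, hnorm]⟩ x
  have hVn : ∀ k, ‖V k‖ = ‖k‖ := by
    intro k
    refine hd.induction (P := fun k => ‖V k‖ = ‖k‖) ?_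
      (isClosed_eq (by fun_prop) (by fun_prop)) k
    rintro _ ⟨x, rfl⟩
    rw [hV]; exact hnorm x
  have hUK : ∀ k : K, K.orthogonalProjectionOnto (k : H) = k := fun k =>
    Submodule.orthogonalProjectionOnto_mem_subspace_eq_self k
  have hker : ∀ x, (V ∘L K.orthogonalProjectionOnto) x = 0 ↔ A x = 0 := by
    intro x
    rw [← norm_eq_zero, ContinuousLinearMap.comp_apply, hVn, norm_eq_zero,
      Submodule.orthogonalProjectionOnto_eq_zero_iff, hK, Submodule.orthogonal_closure,
      Submodule.mem_orthogonal, ← norm_eq_zero (a := A x), ← norm_abs_apply, norm_eq_zero]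
    constructor
    · intro h
      have := h (CFC.abs A (CFC.abs A x)) ⟨_, rfl⟩
      rw [abs_inner] at this
      exact inner_self_eq_zero.1 this
    · rintro h _ ⟨y, rfl⟩
      rw [ContinuousLinearMap.coe_coe, abs_inner, h, inner_zero_right]
  refine ⟨V ∘L K.orthogonalProjectionOnto, ?_, hker, ?_⟩
  · ext x
    rw [mul_apply_eq_comp, ContinuousLinearMap.comp_apply, ← he, hUK, hV]
  · intro x hx
    have hxK : x ∈ K := mem_closure_range_abs A x fun y hy => hx y ((hker y).2 hy)
    rw [ContinuousLinearMap.comp_apply, hVn]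
    have := hUK ⟨x, hxK⟩
    simp only at this
    rw [this]; rfl

theorem IsPolarDecomposition.unique {A U V : H →L[ℂ] H} (hU : IsPolarDecomposition A U)
    (hV : IsPolarDecomposition A V) : U = V := by
  set K := (CFC.abs A).range.topologicalClosure with hK
  have : CompleteSpace K := (Submodule.isClosed_topologicalClosure _).completeSpace_coe
  have h1 : ∀ x ∈ K, U x = V x := by
    intro x hx
    have hx' : x ∈ closure (Set.range ⇑(CFC.abs A : H →L[ℂ] H)) := hx
    refine closure_minimal (s := Set.range ⇑(CFC.abs A : H →L[ℂ] H)) (t := {x | U x = V x}) ?_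
      (isClosed_eq U.continuous V.continuous) hx'
    rintro _ ⟨y, rfl⟩
    have := congrArg (fun T : H →L[ℂ] H => T y) (hU.eq_mul_abs.symm.trans hV.eq_mul_abs)
    exact this
  have h2 : ∀ x ∈ Kᗮ, A x = 0 := by
    intro x hx
    rw [hK, Submodule.orthogonal_closure, Submodule.mem_orthogonal] at hx
    rw [← norm_eq_zero, ← norm_abs_apply, norm_eq_zero]
    have := hx (CFC.abs A (CFC.abs A x)) ⟨_, rfl⟩
    rw [abs_inner] at this
    exact inner_self_eq_zero.1 this
  ext x
  obtain ⟨y, hy, z, hz, rfl⟩ := K.exists_add_mem_mem_orthogonal x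
  rw [map_add, map_add, h1 y hy, (hU.ker_eq z).2 (h2 z hz), (hV.ker_eq z).2 (h2 z hz)]

/-- The partial isometry `U` of the polar decomposition `A = U |A|`. -/
def polarPart (A : H →L[ℂ] H) : H →L[ℂ] H := (exists_isPolarDecomposition A).choose

theorem polarPart_spec (A : H →L[ℂ] H) : IsPolarDecomposition A (polarPart A) :=
  (exists_isPolarDecomposition A).choose_spec

/-- The operator `|A|^(p-1) U* B`, where `A = U |A|` is the polar decomposition of `A`. -/
def bracketOp (p : ℝ) (B A : H →L[ℂ] H) : H →L[ℂ] H :=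
  CFC.abs A ^ (p - 1) * star (polarPart A) * B

/-- The bracket `[B, A] = ‖A‖_p^(2-p) tr (|A|^(p-1) U* B)`. -/
def bracket (p : ℝ) (B A : H →L[ℂ] H) : ℂ :=
  ((pNorm p A ^ (2 - p) : ℝ) : ℂ) * tr (bracketOp p B A)

end Polar

section SemiInner

variable {E : Type*} [AddCommGroup E] [Module ℂ E]

/-- The subset `V` of a complex vector space is a linear subspace, and `N` is a norm on it. -/
structure IsNormedSubspace (V : Set E) (N : E → ℝ) : Prop where
  zero_mem : 0 ∈ V
  add_mem : ∀ x ∈ V, ∀ y ∈ V, x + y ∈ V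
  smul_mem : ∀ (c : ℂ), ∀ x ∈ V, c • x ∈ V
  norm_nonneg : ∀ x ∈ V, 0 ≤ N x
  norm_eq_zero_iff : ∀ x ∈ V, N x = 0 ↔ x = 0
  norm_smul : ∀ (c : ℂ), ∀ x ∈ V, N (c • x) = ‖c‖ * N x
  norm_add_le : ∀ x ∈ V, ∀ y ∈ V, N (x + y) ≤ N x + N y

/-- `s` is a semi-inner product (in the sense of Lumer and Giles) on the normed space `(V, N)`. -/
structure IsSemiInnerProduct (V : Set E) (N : E → ℝ) (s : E → E → ℂ) : Prop
    extends IsNormedSubspace V N where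
  self_eq : ∀ x ∈ V, s x x = ((N x ^ 2 : ℝ) : ℂ)
  linear_left : ∀ x ∈ V, ∀ y ∈ V, ∀ z ∈ V, ∀ a b : ℂ,
    s (a • x + b • y) z = a * s x z + b * s y z
  conj_smul_right : ∀ x ∈ V, ∀ y ∈ V, ∀ c : ℂ, s x (c • y) = conj c * s x y
  norm_sq_le : ∀ x ∈ V, ∀ y ∈ V, ‖s x y‖ ^ 2 ≤ N x ^ 2 * N y ^ 2

/-- Continuity of a semi-inner product in the sense of Giles: for `x`, `y` in the unit sphere,
`Re [y, x + r y] → Re [y, x]` as the real number `r` tends to `0`. -/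
structure IsContinuousSemiInnerProduct (V : Set E) (N : E → ℝ) (s : E → E → ℂ) : Prop
    extends IsSemiInnerProduct V N s where
  tendsto_re : ∀ x ∈ V, ∀ y ∈ V, N x = 1 → N y = 1 →
    Filter.Tendsto (fun r : ℝ => (s y (x + (r : ℂ) • y)).re) (nhds 0) (nhds (s y x).re)

/-- Birkhoff--James orthogonality of `x` to `y` with respect to `N`. -/
def IsBJOrthogonal (N : E → ℝ) (x y : E) : Prop := ∀ c : ℂ, N x ≤ N (x + c • y)

end SemiInner

end

end Schatten

/-!
Everything is read off from singular values. A compact `|A|` is diagonal in a Hilbert basis, with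
eigenvalues `s i`, and its powers act on this basis by `s i ^ r`. The estimate behind all others is
`sum_norm_inner_rpow_le`: if `T` is diagonal with eigenvalues `s`, and `X`, `Y` are contractions,
then the diagonal of `X T Y` in any orthonormal family has `ℓ^r` norm at most that of `s`, because
it is dominated by the image of `s` under a doubly substochastic matrix. Its consequences are:

* Existence and basis independence of traces (`hasTrace_mul`). The operator `|A|^(p-1) U* B` is
  `T Y D`, with `T` diagonal in `ℓ^q`, `Y` a contraction and `D = |B|` diagonal in `ℓ^p`. Partial
  sums of the trace over an arbitrary basis are traces of compressions of `T Y` against `D`, with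
  coefficients bounded in `ℓ^q` and converging coordinatewise.
* The triangle inequality (`add_mem_and_pNorm_add_le`). With `A + B = W |A + B|`, the singular values
  of `A + B` are the diagonal entries of `W* A + W* B` in an eigenbasis of `|A + B|`, and Minkowski's
  inequality in `ℓ^p` applies.
* Hölder's inequality (`norm_tr_bracketOp_le`), which gives `|[B, A]| ≤ ‖B‖_p ‖A‖_p`.

For the continuity of the bracket, the map `A ↦ |A|^(p-1) U*` is continuous for the operator norm
(`continuous_abs_rpow_mul_star_polarPart`), so that along `A + r B` the diagonal coefficients converge
one by one while staying bounded in `ℓ^q`; this suffices against the `ℓ^p` singular values of `B`.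

For orthogonality, if `[B, A] = 0` then `‖A‖² = [A + c B, A] ≤ ‖A + c B‖ ‖A‖`. Conversely, if `A` is
orthogonal to `B` and `X = A + r B` with `r > 0`, then
`‖X‖² = Re [A, X] + r Re [B, X] ≤ ‖X‖² + r Re [B, X]`, so that `Re [B, A] ≥ 0` in the limit `r → 0`,
and this holds for every multiple of `B`.
-/

namespace Schatten

open Filter Topology

/-! ### Diagonal operators -/

section Diagonal

variable {H : Type u} [NormedAddCommGroup H] [InnerProductSpace ℂ H]

theorem mem_spectrum_of_apply_eq_smul {T : H →L[ℂ] H} {v : H} (hv : v ≠ 0) {μ : ℝ}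
    (h : T v = (μ : ℂ) • v) : μ ∈ spectrum ℝ T := by
  intro hu
  obtain ⟨W, hW⟩ := hu.exists_left_inv
  apply hv
  have h1 : (algebraMap ℝ (H →L[ℂ] H) μ - T) v = 0 := by
    rw [sub_apply, h, Algebra.algebraMap_eq_smul_one,
      smul_apply, one_apply_eq_self, Complex.coe_smul, sub_self]
  have h2 := congrArg (fun S : H →L[ℂ] H => S v) hW
  simpa only [mul_apply_eq_comp, h1, map_zero, one_apply_eq_self] using h2.symm

theorem eq_of_apply_basis_eq {ι : Type*} (e : HilbertBasis ι ℂ H) {S T : H →L[ℂ] H}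
    (h : ∀ i, S (e i) = T (e i)) : S = T := by
  refine ContinuousLinearMap.ext_on (s := Set.range e) ?_ ?_
  · exact Submodule.dense_iff_topologicalClosure_eq_top.2 e.dense_span
  · rintro _ ⟨i, rfl⟩
    exact h i

theorem hasSum_inner_apply {ι : Type*} (e : HilbertBasis ι ℂ H) (T : H →L[ℂ] H) (x y : H) :
    HasSum (fun i => ⟪e i, y⟫_ℂ * ⟪x, T (e i)⟫_ℂ) ⟪x, T y⟫_ℂ := by
  have h := ((innerSL ℂ x).comp T).hasSum (e.hasSum_repr y)
  simpa only [ContinuousLinearMap.comp_apply, map_smul, smul_eq_mul, innerSL_apply_apply,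
    HilbertBasis.repr_apply_apply] using h

variable [CompleteSpace H]

/-- A function of a self-adjoint operator acts on eigenvectors through the eigenvalue: this holds
for polynomials, and passes to uniform limits. -/
theorem cfc_apply_eigenvector {T : H →L[ℂ] H} (hT : IsSelfAdjoint T) {f : ℝ → ℝ}
    (hf : Continuous f) {v : H} {μ : ℝ} (h : T v = (μ : ℂ) • v) :
    cfc f T v = ((f μ : ℝ) : ℂ) • v := by
  by_cases hv : v = 0
  · simp [hv]
  have hμ := mem_spectrum_of_apply_eq_smul hv h
  have key : ∀ g : C(spectrum ℝ T, ℝ), cfcHom hT g v = ((g ⟨μ, hμ⟩ : ℝ) : ℂ) • v := by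
    intro g
    have hid : cfcHom hT (.restrict (spectrum ℝ T) (.id ℝ)) v = (μ : ℂ) • v := by
      rw [cfcHom_id, h]
    induction g using ContinuousMap.induction_on_of_compact with
    | const r =>
      have : ContinuousMap.const (spectrum ℝ T) r = algebraMap ℝ _ r := rfl
      rw [this, AlgHomClass.commutes, Algebra.algebraMap_eq_smul_one,
        smul_apply, one_apply_eq_self]
      exact (Complex.coe_smul r v).symm
    | id => exact hid
    | star_id => simpa using hid
    | add g₁ g₂ h₁ h₂ =>
      rw [map_add, add_apply, h₁, h₂, ContinuousMap.add_apply,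
        Complex.ofReal_add, add_smul]
    | mul g₁ g₂ h₁ h₂ =>
      rw [map_mul, mul_apply_eq_comp, h₂, map_smul, h₁, ContinuousMap.mul_apply,
        Complex.ofReal_mul, smul_smul, mul_comm]
    | frequently g hg =>
      have hc : IsClosed {g : C(spectrum ℝ T, ℝ) |
          cfcHom hT g v = ((g ⟨μ, hμ⟩ : ℝ) : ℂ) • v} := by
        refine isClosed_eq ?_ ?_
        · exact (ContinuousLinearMap.apply ℂ H v).continuous.comp (cfcHom_continuous hT)
        · exact (Complex.continuous_ofReal.comp (continuous_eval_const (⟨μ, hμ⟩ : spectrum ℝ T))).smul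
            continuous_const
      exact hc.closure_subset (mem_closure_iff_frequently.2 hg)
  rw [cfc_apply f T hT hf.continuousOn, key]
  rfl

theorem rpow_apply_eigenvector {T : H →L[ℂ] H} (hT : 0 ≤ T) {r : ℝ} (hr : 0 ≤ r) {v : H} {μ : ℝ}
    (hμ : 0 ≤ μ) (h : T v = (μ : ℂ) • v) : (T ^ r) v = ((μ ^ r : ℝ) : ℂ) • v := by
  rw [CFC.rpow_def, cfc_nnreal_eq_real _ T hT]
  have hf : Continuous fun x : ℝ => ((x.toNNReal ^ r : NNReal) : ℝ) :=
    NNReal.continuous_coe.comp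
      ((NNReal.continuous_rpow_const hr).comp continuous_real_toNNReal)
  rw [cfc_apply_eigenvector hT.isSelfAdjoint hf h, NNReal.coe_rpow, Real.coe_toNNReal _ hμ]

open scoped ComplexOrder in
/-- The spectral theorem for a compact nonnegative operator: it is diagonal in some Hilbert
basis. -/
theorem exists_eigenbasis {T : H →L[ℂ] H} (hT : 0 ≤ T) (hc : IsCompactOperator T) :
    ∃ (ι : Type u) (e : HilbertBasis ι ℂ H) (s : ι → ℝ), (∀ i, 0 ≤ s i) ∧
      ∀ i, T (e i) = (s i : ℂ) • e i := by
  have hpos := (ContinuousLinearMap.nonneg_iff_isPositive T).1 hT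
  have hs : (T : H →ₗ[ℂ] H).IsSymmetric := hpos.isSymmetric
  let E : ℂ → Submodule ℂ H := fun μ => Module.End.eigenspace (T : H →ₗ[ℂ] H) μ
  have hE : ∀ μ x, x ∈ E μ ↔ T x = μ • x := fun μ x => Module.End.mem_eigenspace_iff
  have hclosed : ∀ μ, IsClosed (E μ : Set H) := by
    intro μ
    have : (E μ : Set H) = {x | T x = μ • x} := by
      ext x; exact hE μ x
    rw [this]
    exact isClosed_eq T.continuous (continuous_const_smul μ)
  have hcomp : ∀ μ, CompleteSpace (E μ) := fun μ => (hclosed μ).completeSpace_coe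
  choose w b hb using fun μ => exists_hilbertBasis ℂ (E μ)
  let v : (Σ μ, w μ) → H := fun a => (b a.1 a.2 : H)
  have hv : Orthonormal ℂ v :=
    hs.orthogonalFamily_eigenspaces.orthonormal_sigma_orthonormal fun μ => (b μ).orthonormal
  have hsp : (Submodule.span ℂ (Set.range v))ᗮ = ⊥ := by
    rw [eq_bot_iff,
      ← ContinuousLinearMap.orthogonalComplement_iSup_eigenspaces_eq_bot hc hs]
    rw [← Submodule.iInf_orthogonal]
    refine le_iInf fun μ x hx => ?_
    rw [Submodule.mem_orthogonal] at hx ⊢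
    intro y hy
    have h1 := (b μ).hasSum_repr ⟨y, hy⟩
    have h2 := ((E μ).subtypeL.hasSum h1)
    have h3 : HasSum (fun i => ⟪x, ((b μ).repr ⟨y, hy⟩ i • (b μ i) : E μ)⟫_ℂ) ⟪x, y⟫_ℂ :=
      (innerSL ℂ x).hasSum h2
    have h4 : ∀ i, ⟪x, (((b μ).repr ⟨y, hy⟩ i • (b μ i) : E μ) : H)⟫_ℂ = 0 := by
      intro i
      rw [Submodule.coe_smul, inner_smul_right, ← inner_conj_symm,
        hx (b μ i) (Submodule.subset_span ⟨⟨μ, i⟩, rfl⟩), map_zero, mul_zero]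
    simp only [h4] at h3
    rw [← inner_conj_symm, ← hasSum_zero.unique h3, map_zero]
  let e := HilbertBasis.mkOfOrthogonalEqBot hv hsp
  have he : ∀ a, e a = v a := fun a => by
    rw [HilbertBasis.coe_mkOfOrthogonalEqBot]
  have hTe : ∀ a, T (e a) = a.1 • e a := by
    intro a
    rw [he]
    exact (hE _ _).1 (b a.1 a.2).2
  have hval : ∀ a : Σ μ, w μ, 0 ≤ ((a.1).re) ∧ ((a.1.re : ℝ) : ℂ) = a.1 := by
    intro a
    have h1 : 0 ≤ ⟪e a, T (e a)⟫_ℂ := hpos.inner_nonneg_right (e a)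
    have h2 : ⟪e a, T (e a)⟫_ℂ = a.1 := by
      rw [hTe, inner_smul_right, inner_self_eq_norm_sq_to_K, e.orthonormal.1]
      simp
    rw [h2] at h1
    rw [Complex.nonneg_iff] at h1
    exact ⟨h1.1, Complex.ext rfl h1.2⟩
  exact ⟨_, e, fun a => a.1.re, fun a => (hval a).1, fun a => by rw [(hval a).2, hTe]⟩

end Diagonal

/-! ### The polar decomposition -/

section PolarPart

variable {H : Type u} [NormedAddCommGroup H] [InnerProductSpace ℂ H] [CompleteSpace H]

theorem IsPolarDecomposition.norm_le_one {A U : H →L[ℂ] H} (h : IsPolarDecomposition A U) :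
    ‖U‖ ≤ 1 := by
  refine U.opNorm_le_bound zero_le_one fun x => ?_
  set K := U.ker with hK
  have hKc : IsClosed (K : Set H) := U.isClosed_ker
  have : CompleteSpace K := hKc.completeSpace_coe
  obtain ⟨y, hy, z, hz, rfl⟩ := K.exists_add_mem_mem_orthogonal x
  have hy' : U y = 0 := hy
  rw [map_add, hy', zero_add, one_mul,
    h.isometric z fun w hw => (Submodule.mem_orthogonal _ _).1 hz w hw]
  have h1 := norm_add_sq_eq_norm_sq_add_norm_sq_of_inner_eq_zero y z
    ((Submodule.mem_orthogonal _ _).1 hz y hy)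
  nlinarith [norm_nonneg (y + z), norm_nonneg z, norm_nonneg y]

/-- `U* A = |A|` for the polar decomposition `A = U |A|`. -/
theorem IsPolarDecomposition.star_mul {A U : H →L[ℂ] H} (h : IsPolarDecomposition A U) :
    star U * A = CFC.abs A := by
  set K := (CFC.abs A).range.topologicalClosure with hK
  have : CompleteSpace K := (Submodule.isClosed_topologicalClosure _).completeSpace_coe
  have habs : ∀ w, U (CFC.abs A w) = A w := fun w =>
    (congrArg (fun T : H →L[ℂ] H => T w) h.eq_mul_abs).symm
  have hinner : ∀ w x, ⟪A w, A x⟫_ℂ = ⟪CFC.abs A w, CFC.abs A x⟫_ℂ := by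
    intro w x
    rw [abs_inner, ← ContinuousLinearMap.adjoint_inner_right A,
      ← ContinuousLinearMap.star_eq_adjoint]
    have := congrArg (fun T : H →L[ℂ] H => T x) (CFC.abs_mul_abs A)
    simp only [mul_apply_eq_comp] at this
    rw [this]
  ext x
  refine ext_inner_left ℂ fun y => ?_
  rw [mul_apply_eq_comp, ContinuousLinearMap.star_eq_adjoint,
    ContinuousLinearMap.adjoint_inner_right]
  obtain ⟨k, hk, z, hz, rfl⟩ := K.exists_add_mem_mem_orthogonal y
  have hz0 : CFC.abs A z = 0 := by
    rw [hK, Submodule.orthogonal_closure, Submodule.mem_orthogonal] at hz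
    have := hz (CFC.abs A (CFC.abs A z)) ⟨_, rfl⟩
    rw [abs_inner] at this
    exact inner_self_eq_zero.1 this
  have hUz : U z = 0 := by
    rw [h.ker_eq, ← norm_eq_zero, ← norm_abs_apply, hz0, norm_zero]
  have h1 : ∀ k ∈ K, ⟪U k, A x⟫_ℂ = ⟪k, CFC.abs A x⟫_ℂ := by
    intro k hk
    have hk' : k ∈ closure (Set.range ⇑(CFC.abs A : H →L[ℂ] H)) := hk
    refine closure_minimal (s := Set.range ⇑(CFC.abs A : H →L[ℂ] H))
      (t := {k | ⟪U k, A x⟫_ℂ = ⟪k, CFC.abs A x⟫_ℂ}) ?_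
      (isClosed_eq (by fun_prop) (by fun_prop)) hk'
    rintro _ ⟨w, rfl⟩
    change ⟪U (CFC.abs A w), A x⟫_ℂ = _
    rw [habs, hinner]
  have h2 : ⟪z, CFC.abs A x⟫_ℂ = 0 := by rw [← abs_inner, hz0, inner_zero_left]
  rw [map_add, hUz, add_zero, inner_add_left, h2, add_zero, h1 k hk]

theorem norm_star_polarPart_le (A : H →L[ℂ] H) : ‖star (polarPart A)‖ ≤ 1 := by
  rw [norm_star]; exact (polarPart_spec A).norm_le_one

theorem isCompactOperator_abs {A : H →L[ℂ] H} (hA : IsCompactOperator A) :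
    IsCompactOperator (CFC.abs A : H →L[ℂ] H) := by
  have h : ⇑(CFC.abs A : H →L[ℂ] H) = ⇑(star (polarPart A)) ∘ ⇑A := by
    rw [← (polarPart_spec A).star_mul]
    rfl
  rw [h]
  exact hA.clm_comp (star (polarPart A))

theorem polarPart_smul {c : ℂ} (hc : c ≠ 0) (A : H →L[ℂ] H) :
    polarPart (c • A) = (c / ‖c‖ : ℂ) • polarPart A := by
  have hn : (‖c‖ : ℂ) ≠ 0 := by simpa using hc
  have hU := polarPart_spec A
  refine (polarPart_spec (c • A)).unique ⟨?_, fun x => ?_, fun x hx => ?_⟩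
  · rw [CFC.abs_smul, smul_mul_assoc, ← Complex.coe_smul, mul_smul_comm, smul_smul,
      ← hU.eq_mul_abs, div_mul_cancel₀ _ hn]
  · rw [smul_apply, smul_apply, smul_eq_zero,
      smul_eq_zero, hU.ker_eq]
    simp [hc]
  · rw [smul_apply, norm_smul, hU.isometric x]
    · simp [hc]
    · intro y hy
      exact hx y (by rw [smul_apply, hy, smul_zero])

end PolarPart

/-! ### Weak convergence in sequence spaces -/

section Sequences

variable {κ : Type*} {p q : ℝ}

/-- Hölder's inequality for the part of a series outside a finite set, and for the whole series
with `J = ∅`. -/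
theorem summable_and_norm_tsum_sub_sum_le (hpq : p.HolderConjugate q) {t : κ → ℝ}
    (ht : ∀ j, 0 ≤ t j) (hts : Summable fun j => t j ^ p) {x : κ → ℂ} {C : ℝ}
    (hx : ∀ J : Finset κ, ∑ j ∈ J, ‖x j‖ ^ q ≤ C) (J : Finset κ) :
    (Summable fun j => x j * t j) ∧ ‖∑' j, x j * t j - ∑ j ∈ J, x j * t j‖ ≤
      (∑' j : {j // j ∉ J}, t j ^ p) ^ (1 / p) * C ^ (1 / q) := by
  have hxs : Summable fun j => ‖x j‖ ^ q :=
    summable_of_sum_le (fun j => Real.rpow_nonneg (norm_nonneg _) _) hx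
  have hn : ∀ j, ‖x j * t j‖ = t j * ‖x j‖ := fun j => by
    rw [norm_mul, Complex.norm_real, Real.norm_of_nonneg (ht j), mul_comm]
  have hsum : Summable fun j => ‖x j * t j‖ := by
    simp only [hn]
    exact (Real.summable_and_inner_le_Lp_mul_Lq_tsum_of_nonneg hpq ht
      (fun j => norm_nonneg _) hts hxs).1
  refine ⟨hsum.of_norm, ?_⟩
  rw [← hsum.of_norm.sum_add_tsum_subtype_compl J, add_sub_cancel_left]
  refine (norm_tsum_le_tsum_norm (hsum.subtype _)).trans ?_
  simp only [hn]
  refine (Real.inner_le_Lp_mul_Lq_tsum_of_nonneg hpq (f := fun j : {j // j ∉ J} => t j)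
    (g := fun j : {j // j ∉ J} => ‖x j‖) (fun j => ht j) (fun j => norm_nonneg _)
    (hts.subtype _) (hxs.subtype _)).trans ?_
  have h1 : ∑' j : {j // j ∉ J}, ‖x j‖ ^ q ≤ C :=
    (hxs.tsum_subtype_le (fun j => ‖x j‖ ^ q) {j | j ∉ J}
      (fun j => Real.rpow_nonneg (norm_nonneg _) _)).trans
      (Real.tsum_le_of_sum_le (fun j => Real.rpow_nonneg (norm_nonneg _) _) hx)
  refine mul_le_mul_of_nonneg_left (Real.rpow_le_rpow
    (tsum_nonneg fun j => Real.rpow_nonneg (norm_nonneg _) _) h1 hpq.symm.one_div_nonneg) ?_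
  exact Real.rpow_nonneg (tsum_nonneg fun j : {j // j ∉ J} => Real.rpow_nonneg (ht j) p) _

/-- A family bounded in `ℓ^q` that converges coordinatewise converges weakly against `ℓ^p`. -/
theorem tendsto_tsum_mul {α : Type*} {l : Filter α} [l.NeBot] (hpq : p.HolderConjugate q)
    {t : κ → ℝ} (ht : ∀ j, 0 ≤ t j) (hts : Summable fun j => t j ^ p) {x : α → κ → ℂ}
    {y : κ → ℂ} {C : ℝ} (hx : ∀ᶠ n in l, ∀ J : Finset κ, ∑ j ∈ J, ‖x n j‖ ^ q ≤ C)
    (hxy : ∀ j, Tendsto (fun n => x n j) l (𝓝 (y j))) :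
    Tendsto (fun n => ∑' j, x n j * t j) l (𝓝 (∑' j, y j * t j)) := by
  have hy : ∀ J : Finset κ, ∑ j ∈ J, ‖y j‖ ^ q ≤ C := by
    intro J
    refine le_of_tendsto (tendsto_finsetSum J fun j _ =>
      ((hxy j).norm.rpow_const (Or.inr hpq.symm.nonneg))) ?_
    filter_upwards [hx] with n hn using hn J
  have htail : Tendsto (fun J : Finset κ =>
      (∑' j : {j // j ∉ J}, t j ^ p) ^ (1 / p) * C ^ (1 / q)) atTop (𝓝 0) := by
    have h := ((tendsto_tsum_compl_atTop_zero fun j => t j ^ p).rpow_const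
      (p := 1 / p) (Or.inr hpq.one_div_nonneg)).mul_const (C ^ (1 / q))
    rwa [Real.zero_rpow hpq.one_div_ne_zero, zero_mul] at h
  rw [Metric.tendsto_nhds]
  intro ε hε
  obtain ⟨J, hJ⟩ := (htail.eventually_lt_const (show (0 : ℝ) < ε / 3 by positivity)).exists
  have hfin : Tendsto (fun n => ∑ j ∈ J, x n j * t j) l (𝓝 (∑ j ∈ J, y j * t j)) :=
    tendsto_finsetSum J fun j _ => (hxy j).mul_const _
  filter_upwards [hx, Metric.tendsto_nhds.1 hfin (ε / 3) (by positivity)] with n hn hd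
  have h1 := (summable_and_norm_tsum_sub_sum_le hpq ht hts hn J).2
  have h2 := (summable_and_norm_tsum_sub_sum_le hpq ht hts hy J).2
  rw [← dist_eq_norm] at h1 h2
  have h3 := dist_triangle4_right (∑' j, x n j * t j) (∑' j, y j * t j)
    (∑ j ∈ J, x n j * t j) (∑ j ∈ J, y j * t j)
  linarith

end Sequences

/-! ### Diagonals of products with contractions -/

section Pinching

variable {H : Type u} [NormedAddCommGroup H] [InnerProductSpace ℂ H]

theorem norm_apply_sq_le_one {X : H →L[ℂ] H} (hX : ‖X‖ ≤ 1) {x : H} (hx : ‖x‖ = 1) :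
    ‖X x‖ ^ 2 ≤ 1 := by
  have h := X.le_of_opNorm_le hX x
  rw [hx, one_mul] at h
  exact pow_le_one₀ (norm_nonneg _) h

/-- The projection onto the span of finitely many members of a Hilbert basis. -/
noncomputable def finiteProj {κ : Type*} (g : HilbertBasis κ ℂ H) (K : Finset κ) : H →L[ℂ] H :=
  ∑ k ∈ K, InnerProductSpace.rankOne ℂ (g k) (g k)

theorem finiteProj_apply {κ : Type*} (g : HilbertBasis κ ℂ H) (K : Finset κ) (x : H) :
    finiteProj g K x = ∑ k ∈ K, ⟪g k, x⟫_ℂ • g k := by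
  simp [finiteProj, sum_apply]

theorem norm_finiteProj_le {κ : Type*} (g : HilbertBasis κ ℂ H) (K : Finset κ) :
    ‖finiteProj g K‖ ≤ 1 := by
  refine ContinuousLinearMap.opNorm_le_bound _ zero_le_one fun x => ?_
  rw [one_mul, finiteProj_apply]
  have h1 := g.orthonormal.inner_sum (fun k => ⟪g k, x⟫_ℂ) (fun k => ⟪g k, x⟫_ℂ) K
  have h2 := g.orthonormal.sum_inner_products_le x (s := K)
  have h3 : ‖∑ k ∈ K, ⟪g k, x⟫_ℂ • g k‖ ^ 2 = ∑ k ∈ K, ‖⟪g k, x⟫_ℂ‖ ^ 2 := by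
    have h4 : ∀ k, conj ⟪g k, x⟫_ℂ * ⟪g k, x⟫_ℂ = ((‖⟪g k, x⟫_ℂ‖ ^ 2 : ℝ) : ℂ) := fun k => by
      rw [mul_comm, Complex.mul_conj, Complex.normSq_eq_norm_sq]
    simp only [h4, ← Complex.ofReal_sum] at h1
    rw [← inner_self_eq_norm_sq (𝕜 := ℂ), h1]
    rfl
  rw [← h3] at h2
  exact (pow_le_pow_iff_left₀ (norm_nonneg _) (norm_nonneg _) two_ne_zero).1 h2

variable [CompleteSpace H]

/-- For a diagonal operator `T` with eigenvalues `s i`, contractions `X`, `Y` and an orthonormal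
family `d`, the `ℓ^r` norm of the diagonal of `X T Y` is at most that of `s`. Indeed this diagonal
is dominated by the image of `s` under a doubly substochastic matrix `w`. -/
theorem sum_norm_inner_rpow_le {ι κ : Type*} {T X Y : H →L[ℂ] H} {a : HilbertBasis ι ℂ H}
    {s : ι → ℝ} (hs : ∀ i, 0 ≤ s i) (hT : ∀ i, T (a i) = (s i : ℂ) • a i) (hX : ‖X‖ ≤ 1)
    (hY : ‖Y‖ ≤ 1) {r : ℝ} (hr : 1 ≤ r) {S : ℝ} (hS : HasSum (fun i => s i ^ r) S)
    {d : κ → H} (hd : Orthonormal ℂ d) (J : Finset κ) :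
    ∑ j ∈ J, ‖⟪d j, X (T (Y (d j)))⟫_ℂ‖ ^ r ≤ S := by
  have hr0 : 0 ≤ r := zero_le_one.trans hr
  have hX' : ‖star X‖ ≤ 1 := by rwa [norm_star]
  have hY' : ‖star Y‖ ≤ 1 := by rwa [norm_star]
  let w : ι → κ → ℝ := fun i j =>
    (‖⟪a i, star X (d j)⟫_ℂ‖ ^ 2 + ‖⟪a i, Y (d j)⟫_ℂ‖ ^ 2) / 2
  have hw : ∀ i j, 0 ≤ w i j := fun i j => by positivity
  have hcol : ∀ j (I : Finset ι), ∑ i ∈ I, w i j ≤ 1 := by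
    intro j I
    have h1 := a.orthonormal.sum_inner_products_le (star X (d j)) (s := I)
    have h2 := a.orthonormal.sum_inner_products_le (Y (d j)) (s := I)
    have h3 := norm_apply_sq_le_one hX' (hd.1 j)
    have h4 := norm_apply_sq_le_one hY (hd.1 j)
    simp only [w]
    rw [← Finset.sum_div, Finset.sum_add_distrib]
    linarith
  have hrow : ∀ i, ∑ j ∈ J, w i j ≤ 1 := by
    intro i
    have h1 := hd.sum_inner_products_le (X (a i)) (s := J)
    have h2 := hd.sum_inner_products_le (star Y (a i)) (s := J)
    have h3 := norm_apply_sq_le_one hX (a.orthonormal.1 i)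
    have h4 := norm_apply_sq_le_one hY' (a.orthonormal.1 i)
    have h5 : ∀ j, ‖⟪a i, star X (d j)⟫_ℂ‖ = ‖⟪d j, X (a i)⟫_ℂ‖ := fun j => by
      rw [ContinuousLinearMap.star_eq_adjoint, ContinuousLinearMap.adjoint_inner_right,
        norm_inner_symm]
    have h6 : ∀ j, ‖⟪a i, Y (d j)⟫_ℂ‖ = ‖⟪d j, star Y (a i)⟫_ℂ‖ := fun j => by
      rw [ContinuousLinearMap.star_eq_adjoint, ContinuousLinearMap.adjoint_inner_right,
        norm_inner_symm]
    simp only [w, h5, h6]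
    rw [← Finset.sum_div, Finset.sum_add_distrib]
    linarith
  have hsum : ∀ j, HasSum (fun i => ⟪a i, Y (d j)⟫_ℂ * ⟪d j, X (T (a i))⟫_ℂ)
      ⟪d j, X (T (Y (d j)))⟫_ℂ := fun j => hasSum_inner_apply a (X * T) (d j) (Y (d j))
  have hterm : ∀ i j, ‖⟪a i, Y (d j)⟫_ℂ * ⟪d j, X (T (a i))⟫_ℂ‖ ≤ w i j * s i := by
    intro i j
    have h5 : ‖⟪a i, star X (d j)⟫_ℂ‖ = ‖⟪d j, X (a i)⟫_ℂ‖ := by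
      rw [ContinuousLinearMap.star_eq_adjoint, ContinuousLinearMap.adjoint_inner_right,
        norm_inner_symm]
    rw [hT, map_smul, inner_smul_right, norm_mul, norm_mul, Complex.norm_real,
      Real.norm_of_nonneg (hs i), ← h5]
    have := two_mul_le_add_sq ‖⟪a i, star X (d j)⟫_ℂ‖ ‖⟪a i, Y (d j)⟫_ℂ‖
    simp only [w]
    nlinarith [hs i]
  -- finite partial sums in `i`, to which the weighted power mean inequality applies
  have hpart : ∀ I : Finset ι, ∑ j ∈ J,
      ‖∑ i ∈ I, ⟪a i, Y (d j)⟫_ℂ * ⟪d j, X (T (a i))⟫_ℂ‖ ^ r ≤ S := by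
    intro I
    have hj : ∀ j, ‖∑ i ∈ I, ⟪a i, Y (d j)⟫_ℂ * ⟪d j, X (T (a i))⟫_ℂ‖ ^ r ≤
        ∑ i ∈ I, w i j * s i ^ r := by
      intro j
      have h0 : 0 ≤ ∑ i ∈ I, w i j * s i ^ r :=
        Finset.sum_nonneg fun i _ => mul_nonneg (hw i j) (Real.rpow_nonneg (hs i) r)
      have h1 : ‖∑ i ∈ I, ⟪a i, Y (d j)⟫_ℂ * ⟪d j, X (T (a i))⟫_ℂ‖ ≤
          (∑ i ∈ I, w i j * s i ^ r) ^ r⁻¹ := by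
        refine (norm_sum_le_of_le I fun i _ => hterm i j).trans ?_
        refine (Real.inner_le_weight_mul_Lp_of_nonneg I hr (fun i => w i j) s
          (fun i => hw i j) hs).trans ?_
        refine mul_le_of_le_one_left (Real.rpow_nonneg h0 _) ?_
        exact Real.rpow_le_one (Finset.sum_nonneg fun i _ => hw i j) (hcol j I)
          (sub_nonneg.2 (inv_le_one_of_one_le₀ hr))
      refine (Real.rpow_le_rpow (norm_nonneg _) h1 hr0).trans ?_
      rw [Real.rpow_inv_rpow h0 (by positivity)]
    calc _ ≤ ∑ j ∈ J, ∑ i ∈ I, w i j * s i ^ r := Finset.sum_le_sum fun j _ => hj j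
      _ = ∑ i ∈ I, (∑ j ∈ J, w i j) * s i ^ r := by
        rw [Finset.sum_comm]; simp only [Finset.sum_mul]
      _ ≤ ∑ i ∈ I, s i ^ r := Finset.sum_le_sum fun i _ =>
        mul_le_of_le_one_left (Real.rpow_nonneg (hs i) r) (hrow i)
      _ ≤ S := sum_le_hasSum I (fun i _ => Real.rpow_nonneg (hs i) r) hS
  have hlim : Tendsto (fun I : Finset ι => ∑ j ∈ J,
      ‖∑ i ∈ I, ⟪a i, Y (d j)⟫_ℂ * ⟪d j, X (T (a i))⟫_ℂ‖ ^ r) atTop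
      (𝓝 (∑ j ∈ J, ‖⟪d j, X (T (Y (d j)))⟫_ℂ‖ ^ r)) :=
    tendsto_finsetSum J fun j _ => (hsum j).norm.rpow_const (Or.inr hr0)
  exact le_of_tendsto' hlim hpart

/-- The product of a diagonal operator with eigenvalues in `ℓ^q`, a contraction, and a diagonal
operator with eigenvalues in `ℓ^p` has a trace. The partial sum over a finite part `K` of an
arbitrary basis is the trace, computed in the eigenbasis `e` of `D`, of the compression by the
projection onto the span of `K`, so that weak convergence in `ℓ^q` applies. -/
theorem hasTrace_mul {ι κ : Type*} {p q : ℝ} (hpq : p.HolderConjugate q) {T Y D : H →L[ℂ] H}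
    {a : HilbertBasis ι ℂ H} {s : ι → ℝ} (hs : ∀ i, 0 ≤ s i)
    (hT : ∀ i, T (a i) = (s i : ℂ) • a i) (hsq : Summable fun i => s i ^ q)
    (hY : ‖Y‖ ≤ 1) {e : HilbertBasis κ ℂ H} {t : κ → ℝ} (ht : ∀ j, 0 ≤ t j)
    (hD : ∀ j, D (e j) = (t j : ℂ) • e j) (htp : Summable fun j => t j ^ p) :
    HasTrace (T * Y * D) (∑' j, ⟪e j, T (Y (e j))⟫_ℂ * t j) := by
  intro θ g
  have hsumK : ∀ K : Finset θ, ∑ k ∈ K, ⟪g k, (T * Y * D) (g k)⟫_ℂ =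
      ∑' j, ⟪e j, finiteProj g K (T (Y (e j)))⟫_ℂ * t j := by
    intro K
    have h1 := hasSum_sum (s := K) fun k _ => hasSum_inner_apply e (T * Y * D) (g k) (g k)
    rw [← h1.tsum_eq]
    refine tsum_congr fun j => ?_
    rw [finiteProj_apply, inner_sum, Finset.sum_mul]
    refine Finset.sum_congr rfl fun k _ => ?_
    simp only [mul_apply_eq_comp, hD, map_smul, inner_smul_right]
    ring
  unfold HasSum
  simp only [SummationFilter.unconditional_filter, hsumK]
  refine tendsto_tsum_mul hpq ht htp (C := ∑' i, s i ^ q)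
    (Eventually.of_forall fun K J => ?_) fun j => ?_
  · exact sum_norm_inner_rpow_le hs hT (norm_finiteProj_le g K) hY hpq.symm.lt.le hsq.hasSum
      e.orthonormal J
  · have h := g.hasSum_inner_mul_inner (e j) (T (Y (e j)))
    unfold HasSum at h
    simp only [SummationFilter.unconditional_filter] at h
    refine h.congr fun K => ?_
    rw [finiteProj_apply, inner_sum]
    refine Finset.sum_congr rfl fun k _ => ?_
    rw [inner_smul_right, mul_comm]

end Pinching

/-! ### The Schatten norm -/

section SchattenNorm

variable {H : Type u} [NormedAddCommGroup H] [InnerProductSpace ℂ H] [CompleteSpace H]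

theorem abs_rpow_apply_eigenvector {A : H →L[ℂ] H} {r : ℝ} (hr : 0 ≤ r) {v : H} {μ : ℝ}
    (hμ : 0 ≤ μ) (h : CFC.abs A v = (μ : ℂ) • v) :
    (CFC.abs A ^ r) v = ((μ ^ r : ℝ) : ℂ) • v :=
  rpow_apply_eigenvector (CFC.abs_nonneg A) hr hμ h

theorem rpow_sub_one_rpow {p q : ℝ} (hpq : p.HolderConjugate q) {x : ℝ} (hx : 0 ≤ x) :
    (x ^ (p - 1)) ^ q = x ^ p := by
  rw [← Real.rpow_mul hx, hpq.sub_one_mul_conj]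

theorem hasSum_rpow_re_of_hasTrace {p : ℝ} (hp : 0 ≤ p) {A : H →L[ℂ] H} {ι : Type u}
    {e : HilbertBasis ι ℂ H} {s : ι → ℝ} (hs : ∀ i, 0 ≤ s i)
    (h : ∀ i, CFC.abs A (e i) = (s i : ℂ) • e i) {t : ℂ} (ht : HasTrace (CFC.abs A ^ p) t) :
    HasSum (fun i => s i ^ p) t.re := by
  refine (Complex.hasSum_re (ht ι e)).congr_fun ?_
  intro i
  rw [abs_rpow_apply_eigenvector hp (hs i) (h i), inner_smul_right, inner_self_eq_norm_sq_to_K,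
    e.orthonormal.1]
  simp

theorem hasTrace_abs_rpow {p : ℝ} (hp : 1 < p) {A : H →L[ℂ] H} {ι : Type u}
    {e : HilbertBasis ι ℂ H} {s : ι → ℝ} (hs : ∀ i, 0 ≤ s i)
    (h : ∀ i, CFC.abs A (e i) = (s i : ℂ) • e i) (hsum : Summable fun i => s i ^ p) :
    ∃ t, HasTrace (CFC.abs A ^ p) t := by
  have hpq := Real.HolderConjugate.conjExponent hp
  have hfac : CFC.abs A ^ p = CFC.abs A ^ (p - 1) * 1 * CFC.abs A := by
    refine eq_of_apply_basis_eq e fun i => ?_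
    rw [mul_one, mul_apply_eq_comp, h, map_smul,
      abs_rpow_apply_eigenvector (by linarith) (hs i) (h i),
      abs_rpow_apply_eigenvector (by linarith) (hs i) (h i), smul_smul, ← Complex.ofReal_mul]
    congr 3
    rcases (hs i).eq_or_lt with h0 | h0
    · rw [← h0, Real.zero_rpow (by linarith), zero_mul]
    · rw [← Real.rpow_one_add' (hs i) (by linarith)]
      congr 1
      ring
  rw [hfac]
  exact ⟨_, hasTrace_mul hpq (fun i => Real.rpow_nonneg (hs i) (p - 1))
    (fun i => abs_rpow_apply_eigenvector (by linarith) (hs i) (h i))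
    (by simpa only [rpow_sub_one_rpow hpq (hs _)] using hsum)
    ContinuousLinearMap.norm_id_le hs h hsum⟩

theorem pNorm_nonneg {p : ℝ} (hp : 0 ≤ p) {A : H →L[ℂ] H} (hA : A ∈ schattenClass H p) :
    0 ≤ pNorm p A := by
  obtain ⟨hc, t, ht⟩ := hA
  obtain ⟨ι, e, s, hs, h⟩ := exists_eigenbasis (CFC.abs_nonneg A) (isCompactOperator_abs hc)
  rw [pNorm, ht.tr_eq]
  exact Real.rpow_nonneg
    ((hasSum_rpow_re_of_hasTrace hp hs h ht).nonneg fun i => Real.rpow_nonneg (hs i) p) _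

/-- The `p`-th power of the Schatten norm is the sum of the `p`-th powers of the singular
values. -/
theorem hasSum_pNorm_rpow {p : ℝ} (hp : 0 < p) {A : H →L[ℂ] H} (hA : A ∈ schattenClass H p)
    {ι : Type u} {e : HilbertBasis ι ℂ H} {s : ι → ℝ} (hs : ∀ i, 0 ≤ s i)
    (h : ∀ i, CFC.abs A (e i) = (s i : ℂ) • e i) :
    HasSum (fun i => s i ^ p) (pNorm p A ^ p) := by
  obtain ⟨hc, t, ht⟩ := hA
  have hsum := hasSum_rpow_re_of_hasTrace hp.le hs h ht
  rwa [pNorm, ht.tr_eq, one_div, Real.rpow_inv_rpow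
    (hsum.nonneg fun i => Real.rpow_nonneg (hs i) p) hp.ne']

theorem exists_singular_basis {p : ℝ} (hp : 0 < p) {A : H →L[ℂ] H} (hA : A ∈ schattenClass H p) :
    ∃ (ι : Type u) (e : HilbertBasis ι ℂ H) (s : ι → ℝ), (∀ i, 0 ≤ s i) ∧
      (∀ i, CFC.abs A (e i) = (s i : ℂ) • e i) ∧ HasSum (fun i => s i ^ p) (pNorm p A ^ p) := by
  obtain ⟨ι, e, s, hs, h⟩ := exists_eigenbasis (CFC.abs_nonneg A) (isCompactOperator_abs hA.1)
  exact ⟨ι, e, s, hs, h, hasSum_pNorm_rpow hp hA hs h⟩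

theorem mem_schattenClass_of_hasSum {p : ℝ} (hp : 1 < p) {A : H →L[ℂ] H}
    (hc : IsCompactOperator A) {ι : Type u} {e : HilbertBasis ι ℂ H} {s : ι → ℝ}
    (hs : ∀ i, 0 ≤ s i) (h : ∀ i, CFC.abs A (e i) = (s i : ℂ) • e i) {S : ℝ} (hS : 0 ≤ S)
    (hsum : HasSum (fun i => s i ^ p) (S ^ p)) : A ∈ schattenClass H p ∧ pNorm p A = S := by
  have hA : A ∈ schattenClass H p := ⟨hc, hasTrace_abs_rpow hp hs h hsum.summable⟩
  have hp0 : 0 < p := by linarith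
  refine ⟨hA, ?_⟩
  exact (Real.rpow_left_inj (pNorm_nonneg hp0.le hA) hS hp0.ne').1
    ((hasSum_pNorm_rpow hp0 hA hs h).unique hsum)

theorem sum_norm_inner_rpow_le_pNorm {p : ℝ} (hp : 1 ≤ p) {A Z : H →L[ℂ] H}
    (hA : A ∈ schattenClass H p) (hZ : ‖Z‖ ≤ 1) {κ : Type*} {d : κ → H} (hd : Orthonormal ℂ d)
    (J : Finset κ) : ∑ j ∈ J, ‖⟪d j, Z (A (d j))⟫_ℂ‖ ^ p ≤ pNorm p A ^ p := by
  obtain ⟨ι, e, s, hs, h, hsum⟩ := exists_singular_basis (by linarith) hA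
  have hZU : ‖Z * polarPart A‖ ≤ 1 :=
    (norm_mul_le _ _).trans (mul_le_one₀ hZ (norm_nonneg _) (polarPart_spec A).norm_le_one)
  have hAU : ∀ x, A x = polarPart A (CFC.abs A x) := fun x =>
    congrArg (fun T : H →L[ℂ] H => T x) (polarPart_spec A).eq_mul_abs
  have := sum_norm_inner_rpow_le hs h hZU
    (ContinuousLinearMap.norm_id_le : ‖(1 : H →L[ℂ] H)‖ ≤ 1) hp hsum hd J
  simpa only [mul_apply_eq_comp, ContinuousLinearMap.id_apply, ← hAU] using this

/-- The Schatten class is closed under addition, and its norm satisfies the triangle inequality.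
In an eigenbasis `d` of `|A + B|` the singular values of `A + B = W |A + B|` are the diagonal entries
of `W* A + W* B`, so that Minkowski's inequality in `ℓ^p` applies. -/
theorem add_mem_and_pNorm_add_le {p : ℝ} (hp : 1 < p) {A B : H →L[ℂ] H}
    (hA : A ∈ schattenClass H p) (hB : B ∈ schattenClass H p) :
    A + B ∈ schattenClass H p ∧ pNorm p (A + B) ≤ pNorm p A + pNorm p B := by
  have hp0 : 0 < p := by linarith
  have hc : IsCompactOperator (A + B : H →L[ℂ] H) := hA.1.add hB.1
  obtain ⟨κ, d, t, ht, h⟩ := exists_eigenbasis (CFC.abs_nonneg (A + B)) (isCompactOperator_abs hc)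
  set W := star (polarPart (A + B))
  have hW : ‖W‖ ≤ 1 := norm_star_polarPart_le _
  let α : κ → ℝ := fun j => ‖⟪d j, W (A (d j))⟫_ℂ‖
  let β : κ → ℝ := fun j => ‖⟪d j, W (B (d j))⟫_ℂ‖
  have hα : ∀ j, 0 ≤ α j := fun j => norm_nonneg _
  have hβ : ∀ j, 0 ≤ β j := fun j => norm_nonneg _
  have hα' : ∀ j, 0 ≤ α j ^ p := fun j => Real.rpow_nonneg (hα j) p
  have hβ' : ∀ j, 0 ≤ β j ^ p := fun j => Real.rpow_nonneg (hβ j) p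
  have hαs := sum_norm_inner_rpow_le_pNorm hp.le hA hW d.orthonormal
  have hβs := sum_norm_inner_rpow_le_pNorm hp.le hB hW d.orthonormal
  have hle : ∀ j, t j ≤ α j + β j := by
    intro j
    have h1 : ⟪d j, W ((A + B) (d j))⟫_ℂ = (t j : ℂ) := by
      have : W ((A + B) (d j)) = CFC.abs (A + B) (d j) :=
        congrArg (fun T : H →L[ℂ] H => T (d j)) (polarPart_spec (A + B)).star_mul
      rw [this, h, inner_smul_right, inner_self_eq_norm_sq_to_K, d.orthonormal.1]
      simp
    rw [add_apply, map_add, inner_add_right] at h1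
    have h2 := norm_add_le ⟪d j, W (A (d j))⟫_ℂ ⟪d j, W (B (d j))⟫_ℂ
    rwa [h1, Complex.norm_real, Real.norm_of_nonneg (ht j)] at h2
  obtain ⟨hsum, hmink⟩ := Real.Lp_add_le_tsum_of_nonneg hp.le hα hβ
    (summable_of_sum_le hα' hαs) (summable_of_sum_le hβ' hβs)
  have hrle : ∀ j, t j ^ p ≤ (α j + β j) ^ p := fun j =>
    Real.rpow_le_rpow (ht j) (hle j) hp0.le
  have ht' : ∀ j, 0 ≤ t j ^ p := fun j => Real.rpow_nonneg (ht j) p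
  have hts : Summable fun j => t j ^ p := hsum.of_nonneg_of_le ht' hrle
  have hT0 : 0 ≤ ∑' j, t j ^ p := tsum_nonneg ht'
  have hS : HasSum (fun j => t j ^ p) (((∑' j, t j ^ p) ^ (1 / p)) ^ p) := by
    rw [one_div, Real.rpow_inv_rpow hT0 hp0.ne']
    exact hts.hasSum
  obtain ⟨hmem, heq⟩ := mem_schattenClass_of_hasSum hp hc ht h (Real.rpow_nonneg hT0 _) hS
  have hroot : ∀ {N x : ℝ}, 0 ≤ N → 0 ≤ x → x ≤ N ^ p → x ^ (1 / p) ≤ N := by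
    intro N x hN hx hxN
    have := Real.rpow_le_rpow hx hxN (by positivity : 0 ≤ 1 / p)
    rwa [one_div, Real.rpow_rpow_inv hN hp0.ne', ← one_div] at this
  refine ⟨hmem, ?_⟩
  rw [heq]
  calc (∑' j, t j ^ p) ^ (1 / p) ≤ (∑' j, (α j + β j) ^ p) ^ (1 / p) :=
        Real.rpow_le_rpow hT0 (hts.tsum_le_tsum hrle hsum) (by positivity)
    _ ≤ (∑' j, α j ^ p) ^ (1 / p) + (∑' j, β j ^ p) ^ (1 / p) := hmink
    _ ≤ pNorm p A + pNorm p B := add_le_add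
        (hroot (pNorm_nonneg hp0.le hA) (tsum_nonneg hα') (Real.tsum_le_of_sum_le hα' hαs))
        (hroot (pNorm_nonneg hp0.le hB) (tsum_nonneg hβ') (Real.tsum_le_of_sum_le hβ' hβs))

theorem zero_mem_schattenClass {p : ℝ} (hp : 1 < p) :
    (0 : H →L[ℂ] H) ∈ schattenClass H p ∧ pNorm p (0 : H →L[ℂ] H) = 0 := by
  obtain ⟨w, e, -⟩ := exists_hilbertBasis ℂ H
  refine mem_schattenClass_of_hasSum (e := e) (s := fun _ => 0) hp isCompactOperator_zero
    (fun _ => le_rfl) (fun i => by simp) le_rfl ?_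
  simp only [Real.zero_rpow (by linarith : p ≠ 0)]
  exact hasSum_zero

theorem smul_mem_and_pNorm_smul {p : ℝ} (hp : 1 < p) (c : ℂ) {A : H →L[ℂ] H}
    (hA : A ∈ schattenClass H p) :
    c • A ∈ schattenClass H p ∧ pNorm p (c • A) = ‖c‖ * pNorm p A := by
  have hp0 : 0 < p := by linarith
  obtain ⟨ι, e, s, hs, h, hsum⟩ := exists_singular_basis hp0 hA
  refine mem_schattenClass_of_hasSum (e := e) (s := fun i => ‖c‖ * s i) hp (hA.1.smul c)
    (fun i => mul_nonneg (norm_nonneg _) (hs i)) (fun i => ?_)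
    (mul_nonneg (norm_nonneg _) (pNorm_nonneg hp0.le hA)) ?_
  · rw [CFC.abs_smul, smul_apply, h, ← Complex.coe_smul, smul_smul, Complex.ofReal_mul]
  · simp only [Real.mul_rpow (norm_nonneg c) (hs _),
      Real.mul_rpow (norm_nonneg c) (pNorm_nonneg hp0.le hA)]
    exact hsum.mul_left _

theorem pNorm_eq_zero_iff {p : ℝ} (hp : 1 < p) {A : H →L[ℂ] H} (hA : A ∈ schattenClass H p) :
    pNorm p A = 0 ↔ A = 0 := by
  have hp0 : 0 < p := by linarith
  refine ⟨fun h0 => ?_, fun h0 => h0 ▸ (zero_mem_schattenClass hp).2⟩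
  obtain ⟨ι, e, s, hs, h, hsum⟩ := exists_singular_basis hp0 hA
  rw [h0, Real.zero_rpow hp0.ne', hasSum_zero_iff_of_nonneg fun i => Real.rpow_nonneg (hs i) p]
    at hsum
  rw [← CFC.abs_eq_zero_iff]
  refine eq_of_apply_basis_eq e fun i => ?_
  have hi : s i = 0 := (Real.rpow_eq_zero (hs i) hp0.ne').1 (congrFun hsum i)
  rw [h, hi]
  simp

theorem isNormedSubspace_schattenClass {p : ℝ} (hp : 1 < p) :
    IsNormedSubspace (schattenClass H p) (pNorm p) where
  zero_mem := (zero_mem_schattenClass hp).1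
  add_mem _ hx _ hy := (add_mem_and_pNorm_add_le hp hx hy).1
  smul_mem c _ hx := (smul_mem_and_pNorm_smul hp c hx).1
  norm_nonneg _ hx := pNorm_nonneg (by linarith) hx
  norm_eq_zero_iff _ hx := pNorm_eq_zero_iff hp hx
  norm_smul c _ hx := (smul_mem_and_pNorm_smul hp c hx).2
  norm_add_le _ hx _ hy := (add_mem_and_pNorm_add_le hp hx hy).2

end SchattenNorm

/-! ### The bracket -/

section Bracket

variable {H : Type u} [NormedAddCommGroup H] [InnerProductSpace ℂ H]

theorem HasTrace.add {S T : H →L[ℂ] H} {s t : ℂ} (hS : HasTrace S s) (hT : HasTrace T t) :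
    HasTrace (S + T) (s + t) := fun ι e => by
  simpa only [add_apply, inner_add_right] using (hS ι e).add (hT ι e)

theorem HasTrace.smul {T : H →L[ℂ] H} {t : ℂ} (c : ℂ) (hT : HasTrace T t) :
    HasTrace (c • T) (c * t) := fun ι e => by
  simpa only [smul_apply, inner_smul_right] using (hT ι e).mul_left c

variable [CompleteSpace H]

theorem norm_star_polarPart_mul_le (A B : H →L[ℂ] H) :
    ‖star (polarPart A) * polarPart B‖ ≤ 1 :=
  (norm_mul_le _ _).trans
    (mul_le_one₀ (norm_star_polarPart_le A) (norm_nonneg _) (polarPart_spec B).norm_le_one)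

/-- The diagonal of `|A|^(p-1) U* V`, with `U`, `V` the partial isometries of `A` and `B`, has
`ℓ^q` norm at most `‖A‖_p^(p-1)`. -/
theorem sum_norm_inner_abs_rpow_le {p q : ℝ} (hpq : p.HolderConjugate q) {A : H →L[ℂ] H}
    (hA : A ∈ schattenClass H p) (B : H →L[ℂ] H) {κ : Type*} {d : κ → H}
    (hd : Orthonormal ℂ d) (J : Finset κ) :
    ∑ j ∈ J, ‖⟪d j, (CFC.abs A ^ (p - 1) * star (polarPart A)) (polarPart B (d j))⟫_ℂ‖ ^ q ≤
      pNorm p A ^ p := by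
  obtain ⟨ι, e, s, hs, h, hsum⟩ := exists_singular_basis hpq.pos hA
  exact sum_norm_inner_rpow_le (fun i => Real.rpow_nonneg (hs i) (p - 1))
    (fun i => abs_rpow_apply_eigenvector hpq.sub_one_pos.le (hs i) (h i))
    (ContinuousLinearMap.norm_id_le : ‖(1 : H →L[ℂ] H)‖ ≤ 1) (norm_star_polarPart_mul_le A B)
    hpq.symm.lt.le (by simpa only [rpow_sub_one_rpow hpq (hs _)] using hsum) hd J

theorem hasTrace_bracketOp {p : ℝ} (hp : 1 < p) {A B : H →L[ℂ] H} (hA : A ∈ schattenClass H p)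
    {κ : Type u} {e : HilbertBasis κ ℂ H} {t : κ → ℝ} (ht : ∀ j, 0 ≤ t j)
    (he : ∀ j, CFC.abs B (e j) = (t j : ℂ) • e j) (hts : Summable fun j => t j ^ p) :
    HasTrace (bracketOp p B A)
      (∑' j, ⟪e j, (CFC.abs A ^ (p - 1) * star (polarPart A)) (polarPart B (e j))⟫_ℂ * t j) := by
  have hpq := Real.HolderConjugate.conjExponent hp
  obtain ⟨ι, a, s, hs, h, hsum⟩ := exists_singular_basis hpq.pos hA
  have hfac : bracketOp p B A =
      CFC.abs A ^ (p - 1) * (star (polarPart A) * polarPart B) * CFC.abs B := by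
    rw [bracketOp, mul_assoc, mul_assoc, mul_assoc, ← (polarPart_spec B).eq_mul_abs]
  rw [hfac]
  exact hasTrace_mul hpq (fun i => Real.rpow_nonneg (hs i) (p - 1))
    (fun i => abs_rpow_apply_eigenvector hpq.sub_one_pos.le (hs i) (h i))
    (by simpa only [rpow_sub_one_rpow hpq (hs _)] using hsum.summable)
    (norm_star_polarPart_mul_le A B) ht he hts

theorem exists_hasTrace_bracketOp {p : ℝ} (hp : 1 < p) {A B : H →L[ℂ] H}
    (hA : A ∈ schattenClass H p) (hB : B ∈ schattenClass H p) :
    ∃ t, HasTrace (bracketOp p B A) t := by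
  obtain ⟨κ, e, t, ht, he, hsum⟩ := exists_singular_basis (by linarith) hB
  exact ⟨_, hasTrace_bracketOp hp hA ht he hsum.summable⟩

/-- Hölder's inequality `|tr (|A|^(p-1) U* B)| ≤ ‖A‖_p^(p-1) ‖B‖_p`. -/
theorem norm_tr_bracketOp_le {p : ℝ} (hp : 1 < p) {A B : H →L[ℂ] H}
    (hA : A ∈ schattenClass H p) (hB : B ∈ schattenClass H p) :
    ‖tr (bracketOp p B A)‖ ≤ pNorm p B * pNorm p A ^ (p - 1) := by
  have hpq := Real.HolderConjugate.conjExponent hp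
  obtain ⟨κ, e, t, ht, he, hsum⟩ := exists_singular_basis hpq.pos hB
  rw [(hasTrace_bracketOp hp hA ht he hsum.summable).tr_eq]
  have h1 := (summable_and_norm_tsum_sub_sum_le hpq ht hsum.summable
    (sum_norm_inner_abs_rpow_le hpq hA B e.orthonormal) ∅).2
  have h2 := hsum.summable.sum_add_tsum_subtype_compl ∅
  rw [Finset.sum_empty, zero_add, hsum.tsum_eq] at h2
  rw [Finset.sum_empty, sub_zero, h2, one_div, Real.rpow_rpow_inv (pNorm_nonneg hpq.nonneg hB)
    hpq.ne_zero, ← Real.rpow_mul (pNorm_nonneg hpq.nonneg hA), mul_one_div,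
    hpq.div_conj_eq_sub_one] at h1
  exact h1

theorem bracket_zero_right {p : ℝ} (hp : 1 < p) (B : H →L[ℂ] H) : bracket p B 0 = 0 := by
  have h0 : (0 : H →L[ℂ] H) ^ (p - 1) = 0 := CFC.zero_rpow (by linarith)
  have ht : HasTrace (0 : H →L[ℂ] H) 0 := fun ι e => by simp
  rw [bracket, bracketOp, CFC.abs_zero, h0, zero_mul, zero_mul, ht.tr_eq, mul_zero]

theorem norm_bracket_le {p : ℝ} (hp : 1 < p) {A B : H →L[ℂ] H}
    (hA : A ∈ schattenClass H p) (hB : B ∈ schattenClass H p) :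
    ‖bracket p B A‖ ≤ pNorm p B * pNorm p A := by
  have hN := pNorm_nonneg (by linarith) hA
  rcases hN.eq_or_lt with h0 | h0
  · rw [(pNorm_eq_zero_iff hp hA).1 h0.symm, bracket_zero_right hp, norm_zero,
      (zero_mem_schattenClass hp).2, mul_zero]
  · rw [bracket, norm_mul, Complex.norm_real, Real.norm_of_nonneg (Real.rpow_nonneg hN _)]
    calc _ ≤ pNorm p A ^ (2 - p) * (pNorm p B * pNorm p A ^ (p - 1)) :=
          mul_le_mul_of_nonneg_left (norm_tr_bracketOp_le hp hA hB) (Real.rpow_nonneg hN _)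
      _ = pNorm p B * (pNorm p A ^ (2 - p) * pNorm p A ^ (p - 1)) := by ring
      _ = pNorm p B * pNorm p A := by
        rw [← Real.rpow_add h0]
        norm_num

theorem bracket_self {p : ℝ} (hp : 1 < p) {A : H →L[ℂ] H} (hA : A ∈ schattenClass H p) :
    bracket p A A = ((pNorm p A ^ 2 : ℝ) : ℂ) := by
  have hN := pNorm_nonneg (by linarith) hA
  rcases hN.eq_or_lt with h0 | h0
  · rw [(pNorm_eq_zero_iff hp hA).1 h0.symm, bracket_zero_right hp,
      (zero_mem_schattenClass hp).2]
    simp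
  obtain ⟨κ, e, t, ht, he, hsum⟩ := exists_singular_basis (by linarith) hA
  obtain ⟨τ, hτ⟩ := exists_hasTrace_bracketOp hp hA hA
  have h1 : bracketOp p A A = CFC.abs A ^ (p - 1) * CFC.abs A := by
    rw [bracketOp, mul_assoc, (polarPart_spec A).star_mul]
  have h2 : τ = ((pNorm p A ^ p : ℝ) : ℂ) := by
    refine (hτ κ e).unique ((Complex.hasSum_ofReal.2 hsum).congr_fun fun j => ?_)
    rw [h1, mul_apply_eq_comp, he, map_smul,
      abs_rpow_apply_eigenvector (by linarith) (ht j) (he j), smul_smul, inner_smul_right,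
      inner_self_eq_norm_sq_to_K, e.orthonormal.1, ← Complex.ofReal_mul,
      ← Real.rpow_one_add' (ht j) (by linarith)]
    simp
  rw [bracket, hτ.tr_eq, h2, ← Complex.ofReal_mul, ← Real.rpow_add h0]
  norm_num

theorem bracket_linear_left {p : ℝ} (hp : 1 < p) {A B C : H →L[ℂ] H}
    (hA : A ∈ schattenClass H p) (hB : B ∈ schattenClass H p) (hC : C ∈ schattenClass H p)
    (a b : ℂ) : bracket p (a • A + b • B) C = a * bracket p A C + b * bracket p B C := by
  obtain ⟨s, hs⟩ := exists_hasTrace_bracketOp hp hC hA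
  obtain ⟨t, ht⟩ := exists_hasTrace_bracketOp hp hC hB
  have h : bracketOp p (a • A + b • B) C = a • bracketOp p A C + b • bracketOp p B C := by
    simp only [bracketOp, mul_add, mul_smul_comm]
  simp only [bracket]
  rw [h, ((hs.smul a).add (ht.smul b)).tr_eq, hs.tr_eq, ht.tr_eq]
  ring

theorem bracket_smul_right {p : ℝ} (hp : 1 < p) {A B : H →L[ℂ] H}
    (hA : A ∈ schattenClass H p) (hB : B ∈ schattenClass H p) (c : ℂ) :
    bracket p B (c • A) = conj c * bracket p B A := by
  by_cases hc : c = 0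
  · rw [hc, zero_smul, bracket_zero_right hp, map_zero, zero_mul]
  have hn : 0 < ‖c‖ := norm_pos_iff.2 hc
  obtain ⟨ι, e, s, hs, h, -⟩ := exists_singular_basis (by linarith) hA
  obtain ⟨t, ht⟩ := exists_hasTrace_bracketOp hp hA hB
  have hpow : CFC.abs (c • A) ^ (p - 1) = ((‖c‖ ^ (p - 1) : ℝ) : ℂ) • CFC.abs A ^ (p - 1) := by
    refine eq_of_apply_basis_eq e fun i => ?_
    rw [smul_apply, abs_rpow_apply_eigenvector (by linarith) (hs i) (h i),
      abs_rpow_apply_eigenvector (by linarith) (mul_nonneg hn.le (hs i)), smul_smul,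
      ← Complex.ofReal_mul, Real.mul_rpow hn.le (hs i)]
    rw [CFC.abs_smul, smul_apply, h, ← Complex.coe_smul, smul_smul, Complex.ofReal_mul]
  have hop : bracketOp p B (c • A) =
      (((‖c‖ ^ (p - 1) : ℝ) : ℂ) * (conj c / ‖c‖)) • bracketOp p B A := by
    have hstar : star (c / (‖c‖ : ℂ)) = conj c / ‖c‖ := by simp
    simp only [bracketOp]
    rw [hpow, polarPart_smul hc, star_smul, hstar, smul_mul_smul_comm, smul_mul_assoc]
  rw [bracket, bracket, hop, (ht.smul _).tr_eq, ht.tr_eq, (smul_mem_and_pNorm_smul hp c hA).2,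
    Real.mul_rpow hn.le (pNorm_nonneg (by linarith) hA)]
  have hcc : ((‖c‖ ^ (2 - p) : ℝ) : ℂ) * ((‖c‖ ^ (p - 1) : ℝ) : ℂ) = ‖c‖ := by
    rw [← Complex.ofReal_mul, ← Real.rpow_add hn]
    norm_num
  have hn' : (‖c‖ : ℂ) ≠ 0 := by exact_mod_cast hn.ne'
  rw [Complex.ofReal_mul]
  calc _ = (((‖c‖ ^ (2 - p) : ℝ) : ℂ) * ((‖c‖ ^ (p - 1) : ℝ) : ℂ)) / ‖c‖ *
        (conj c * (((pNorm p A ^ (2 - p) : ℝ) : ℂ) * t)) := by ring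
    _ = _ := by rw [hcc, div_self hn', one_mul]

theorem isSemiInnerProduct_bracket {p : ℝ} (hp : 1 < p) :
    IsSemiInnerProduct (schattenClass H p) (pNorm p) (bracket p) where
  toIsNormedSubspace := isNormedSubspace_schattenClass hp
  self_eq _ hx := bracket_self hp hx
  linear_left _ hx _ hy _ hz a b := bracket_linear_left hp hx hy hz a b
  conj_smul_right _ hx _ hy c := bracket_smul_right hp hy hx c
  norm_sq_le _ hx _ hy := by
    rw [← mul_pow]
    exact pow_le_pow_left₀ (norm_nonneg _) (norm_bracket_le hp hy hx) 2

end Bracket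

/-! ### Continuity and Birkhoff--James orthogonality -/

section Continuity

variable {H : Type u} [NormedAddCommGroup H] [InnerProductSpace ℂ H] [CompleteSpace H]

/-- The map `A ↦ |A|^r U*` is continuous for the operator norm although `A ↦ U` is not. It is the
uniform limit as `δ → 0` of the continuous maps `A ↦ k(|A|) A*` with `k(x) = x^r / max x δ`:
since `A* = |A| U*`, the error is at most `sup |x^r - x k(x)| ≤ δ^r`. -/
theorem continuous_abs_rpow_mul_star_polarPart {r : ℝ} (hr : 0 < r) :
    Continuous fun A : H →L[ℂ] H => CFC.abs A ^ r * star (polarPart A) := by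
  refine continuous_of_uniform_approx_of_continuous fun u hu => ?_
  obtain ⟨ε, hε, hu⟩ := Metric.mem_uniformity_dist.1 hu
  obtain ⟨δ, hδ, hδε⟩ : ∃ δ : NNReal, 0 < δ ∧ ((δ ^ r : NNReal) : ℝ) < ε := by
    have h1 : Tendsto (fun δ : NNReal => ((δ ^ r : NNReal) : ℝ)) (𝓝[>] 0) (𝓝 0) := by
      have h2 : Continuous fun δ : NNReal => ((δ ^ r : NNReal) : ℝ) :=
        NNReal.continuous_coe.comp (NNReal.continuous_rpow_const hr.le)
      have h3 := h2.tendsto 0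
      simp only [NNReal.zero_rpow hr.ne', NNReal.coe_zero] at h3
      exact h3.mono_left nhdsWithin_le_nhds
    obtain ⟨δ, h2, h3⟩ := ((h1.eventually_lt_const hε).and self_mem_nhdsWithin).exists
    exact ⟨δ, h3, h2⟩
  let k : NNReal → NNReal := fun x => x ^ r / max x δ
  have hmax : ∀ x : NNReal, max x δ ≠ 0 := fun x => (lt_max_of_lt_right hδ).ne'
  have hk : Continuous k :=
    (NNReal.continuous_rpow_const hr.le).div₀ (continuous_id.max continuous_const) hmax
  let m : NNReal → NNReal := fun x => x ^ r - k x * x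
  have hm : Continuous m := (NNReal.continuous_rpow_const hr.le).sub (hk.mul continuous_id)
  have hkx : ∀ x, k x * x ≤ x ^ r := by
    intro x
    simp only [k]
    rw [div_mul_eq_mul_div]
    exact div_le_of_le_mul₀ zero_le zero_le (by gcongr; exact le_max_left _ _)
  have hmδ : ∀ x, m x ≤ δ ^ r := by
    intro x
    rw [tsub_le_iff_right]
    rcases le_total x δ with h | h
    · exact (NNReal.rpow_le_rpow h hr.le).trans le_self_add
    · have : k x * x = x ^ r := by
        simp only [k]
        rw [max_eq_left h, div_mul_cancel₀ _ (hδ.trans_le h).ne']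
      rw [this]
      exact le_add_self
  refine ⟨fun A => cfc k (CFC.abs A) * star A, ?_, fun A => hu ?_⟩
  · refine Continuous.mul ?_ continuous_star
    exact Continuous.cfc_nnreal_of_mem_nhdsSet (s := Set.univ) k univ_mem CFC.continuous_abs
      (fun A => CFC.abs_nonneg A) hk.continuousOn
  · have hsa : star (CFC.abs A) = CFC.abs A := (CFC.abs_nonneg A).isSelfAdjoint
    have hstar : star A = CFC.abs A * star (polarPart A) := by
      conv_lhs => rw [(polarPart_spec A).eq_mul_abs, star_mul, hsa]
    have hpow : CFC.abs A ^ r = cfc k (CFC.abs A) * CFC.abs A + cfc m (CFC.abs A) := by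
      have h1 : cfc k (CFC.abs A) * CFC.abs A = cfc (fun x => k x * x) (CFC.abs A) := by
        rw [cfc_mul k (fun x => x) (CFC.abs A) hk.continuousOn continuousOn_id,
          cfc_id' NNReal (CFC.abs A) (CFC.abs_nonneg A)]
      rw [h1, ← cfc_add (a := CFC.abs A) (fun x => k x * x) m
        (hk.mul continuous_id).continuousOn hm.continuousOn, CFC.rpow_def]
      refine cfc_congr fun x _ => ?_
      exact (add_tsub_cancel_of_le (hkx x)).symm
    change dist _ (cfc k (CFC.abs A) * star A) < ε
    rw [dist_eq_norm, hpow, hstar, add_mul, mul_assoc, add_sub_cancel_left]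
    have h1 : ‖cfc m (CFC.abs A)‖ ≤ ((δ ^ r : NNReal) : ℝ) :=
      NNReal.coe_le_coe.2 (nnnorm_cfc_nnreal_le fun x _ => hmδ x)
    calc ‖cfc m (CFC.abs A) * star (polarPart A)‖
        ≤ ‖cfc m (CFC.abs A)‖ * ‖star (polarPart A)‖ := norm_mul_le _ _
      _ ≤ ‖cfc m (CFC.abs A)‖ :=
        mul_le_of_le_one_right (norm_nonneg _) (norm_star_polarPart_le A)
      _ < ε := h1.trans_lt hδε

theorem tendsto_tr_bracketOp {p : ℝ} (hp : 1 < p) {α : Type*} {l : Filter α} [l.NeBot]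
    {X : α → H →L[ℂ] H} {A B : H →L[ℂ] H} (hX : ∀ n, X n ∈ schattenClass H p)
    (hA : A ∈ schattenClass H p) (hB : B ∈ schattenClass H p) (hXA : Tendsto X l (𝓝 A)) {M : ℝ}
    (hM : ∀ᶠ n in l, pNorm p (X n) ≤ M) :
    Tendsto (fun n => tr (bracketOp p B (X n))) l (𝓝 (tr (bracketOp p B A))) := by
  have hpq := Real.HolderConjugate.conjExponent hp
  obtain ⟨κ, e, t, ht, he, hsum⟩ := exists_singular_basis hpq.pos hB
  simp only [fun n => (hasTrace_bracketOp hp (hX n) ht he hsum.summable).tr_eq,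
    (hasTrace_bracketOp hp hA ht he hsum.summable).tr_eq]
  refine tendsto_tsum_mul hpq ht hsum.summable (C := M ^ p) ?_ fun j => ?_
  · filter_upwards [hM] with n hn J
    exact (sum_norm_inner_abs_rpow_le hpq (hX n) B e.orthonormal J).trans
      (Real.rpow_le_rpow (pNorm_nonneg hpq.nonneg (hX n)) hn hpq.nonneg)
  · have h1 := ((continuous_abs_rpow_mul_star_polarPart (H := H) hpq.sub_one_pos).tendsto A).comp
      hXA
    have h2 : Continuous fun T : H →L[ℂ] H => ⟪e j, T (polarPart B (e j))⟫_ℂ := by fun_prop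
    exact (h2.tendsto _).comp h1

theorem tendsto_pNorm_add_smul {p : ℝ} (hp : 1 < p) {A B : H →L[ℂ] H}
    (hA : A ∈ schattenClass H p) (hB : B ∈ schattenClass H p) :
    Tendsto (fun r : ℝ => pNorm p (A + (r : ℂ) • B)) (𝓝 0) (𝓝 (pNorm p A)) := by
  have hN := isNormedSubspace_schattenClass (H := H) hp
  have hup : ∀ r : ℝ, pNorm p (A + (r : ℂ) • B) ≤ pNorm p A + |r| * pNorm p B := by
    intro r
    have h1 := hN.norm_add_le A hA ((r : ℂ) • B) (hN.smul_mem r B hB)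
    rwa [hN.norm_smul r B hB, Complex.norm_real, Real.norm_eq_abs] at h1
  have hlow : ∀ r : ℝ, pNorm p A - |r| * pNorm p B ≤ pNorm p (A + (r : ℂ) • B) := by
    intro r
    have hmem := hN.add_mem A hA _ (hN.smul_mem r B hB)
    have h1 := hN.norm_add_le (A + (r : ℂ) • B) hmem ((-r : ℂ) • B) (hN.smul_mem _ B hB)
    rw [hN.norm_smul _ B hB, norm_neg, Complex.norm_real, Real.norm_eq_abs, neg_smul,
      add_neg_cancel_right] at h1
    linarith
  have habs : Tendsto (fun r : ℝ => |r| * pNorm p B) (𝓝 0) (𝓝 0) := by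
    have h : Continuous fun r : ℝ => |r| * pNorm p B := by fun_prop
    simpa using h.tendsto 0
  refine tendsto_of_tendsto_of_tendsto_of_le_of_le ?_ ?_ hlow hup
  · simpa using habs.const_sub (pNorm p A)
  · simpa using habs.const_add (pNorm p A)

theorem tendsto_bracket_add_smul {p : ℝ} (hp : 1 < p) {A B : H →L[ℂ] H}
    (hA : A ∈ schattenClass H p) (hB : B ∈ schattenClass H p) (hA0 : A ≠ 0) :
    Tendsto (fun r : ℝ => bracket p B (A + (r : ℂ) • B)) (𝓝 0) (𝓝 (bracket p B A)) := by
  have hN := isNormedSubspace_schattenClass (H := H) hp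
  have hnorm := tendsto_pNorm_add_smul hp hA hB
  have hpow : Tendsto (fun r : ℝ => ((pNorm p (A + (r : ℂ) • B) ^ (2 - p) : ℝ) : ℂ)) (𝓝 0)
      (𝓝 ((pNorm p A ^ (2 - p) : ℝ) : ℂ)) :=
    (Complex.continuous_ofReal.tendsto _).comp
      (hnorm.rpow_const (Or.inl (mt (hN.norm_eq_zero_iff A hA).1 hA0)))
  have hXA : Tendsto (fun r : ℝ => A + (r : ℂ) • B) (𝓝 0) (𝓝 A) := by
    have h : Continuous fun r : ℝ => A + (r : ℂ) • B := by fun_prop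
    simpa using h.tendsto 0
  exact hpow.mul (tendsto_tr_bracketOp hp (fun r => hN.add_mem A hA _ (hN.smul_mem _ B hB)) hA hB
    hXA (hnorm.eventually_le_const (lt_add_one (pNorm p A))))

theorem isContinuousSemiInnerProduct_bracket {p : ℝ} (hp : 1 < p) :
    IsContinuousSemiInnerProduct (schattenClass H p) (pNorm p) (bracket p) where
  toIsSemiInnerProduct := isSemiInnerProduct_bracket hp
  tendsto_re A hA B hB hA1 _ := by
    refine (Complex.continuous_re.tendsto _).comp (tendsto_bracket_add_smul hp hA hB ?_)
    rintro rfl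
    exact zero_ne_one ((zero_mem_schattenClass hp).2.symm.trans hA1)

/-- If `A` is orthogonal to `B`, then `Re [B, A + r B] ≥ 0` for `r > 0`, and this passes to the
limit `r → 0`. -/
theorem re_bracket_nonneg_of_isBJOrthogonal {p : ℝ} (hp : 1 < p) {A B : H →L[ℂ] H}
    (hA : A ∈ schattenClass H p) (hB : B ∈ schattenClass H p) (hA0 : A ≠ 0)
    (h : IsBJOrthogonal (pNorm p) A B) : 0 ≤ (bracket p B A).re := by
  have hN := isNormedSubspace_schattenClass (H := H) hp
  have hlim := ((Complex.continuous_re.tendsto _).comp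
    (tendsto_bracket_add_smul hp hA hB hA0)).mono_left (nhdsWithin_le_nhds (s := Set.Ioi 0))
  refine ge_of_tendsto hlim ?_
  filter_upwards [self_mem_nhdsWithin] with r hr
  have hr : 0 < r := hr
  set X := A + (r : ℂ) • B with hXdef
  have hX : X ∈ schattenClass H p := hN.add_mem A hA _ (hN.smul_mem r B hB)
  have h1 : bracket p X X = bracket p A X + r * bracket p B X := by
    have := bracket_linear_left hp hA hB hX 1 r
    rwa [one_smul, one_mul] at this
  rw [bracket_self hp hX] at h1
  have h2 := congrArg Complex.re h1
  rw [Complex.ofReal_re, Complex.add_re, Complex.re_ofReal_mul] at h2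
  have h3 := (Complex.re_le_norm _).trans (norm_bracket_le hp hX hA)
  have h4 := mul_le_mul_of_nonneg_right (h r) (hN.norm_nonneg X hX)
  have h5 : 0 ≤ r * (bracket p B X).re := by nlinarith
  exact nonneg_of_mul_nonneg_right h5 hr

theorem isBJOrthogonal_iff_bracket_eq_zero {p : ℝ} (hp : 1 < p) {A B : H →L[ℂ] H}
    (hA : A ∈ schattenClass H p) (hB : B ∈ schattenClass H p) :
    IsBJOrthogonal (pNorm p) A B ↔ bracket p B A = 0 := by
  have hN := isNormedSubspace_schattenClass (H := H) hp
  constructor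
  · intro h
    by_cases hA0 : A = 0
    · rw [hA0, bracket_zero_right hp]
    -- rotate `B` so that the bracket becomes nonpositive
    set c : ℂ := -conj (bracket p B A) with hc
    have hcB : IsBJOrthogonal (pNorm p) A (c • B) := fun z => by
      rw [smul_smul]; exact h _
    have h1 := re_bracket_nonneg_of_isBJOrthogonal hp hA (hN.smul_mem c B hB) hA0 hcB
    have h2 : bracket p (c • B) A = c * bracket p B A := by
      have := bracket_linear_left hp hB hB hA c 0
      rwa [zero_smul, add_zero, zero_mul, add_zero] at this
    rw [h2, hc, neg_mul, ← Complex.normSq_eq_conj_mul_self, Complex.neg_re, Complex.ofReal_re] at h1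
    exact Complex.normSq_eq_zero.1 (le_antisymm (by linarith) (Complex.normSq_nonneg _))
  · intro h c
    have hX : A + c • B ∈ schattenClass H p := hN.add_mem A hA _ (hN.smul_mem c B hB)
    rcases (hN.norm_nonneg A hA).eq_or_lt with h0 | h0
    · rw [← h0]; exact hN.norm_nonneg _ hX
    have h1 := bracket_linear_left hp hA hB hA 1 c
    rw [one_smul, one_mul, h, mul_zero, add_zero, bracket_self hp hA] at h1
    have h2 := norm_bracket_le hp hA hX
    rw [h1, Complex.norm_real, Real.norm_of_nonneg (sq_nonneg _), sq] at h2
    exact le_of_mul_le_mul_right h2 h0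

end Continuity

end Schatten

theorem theorem3p8 {H : Type u} [NormedAddCommGroup H] [InnerProductSpace ℂ H] [CompleteSpace H]
    [TopologicalSpace.SeparableSpace H] (p : ℝ) (hp : 1 < p) :
    -- the trace that occurs in the bracket exists
    (∀ A ∈ Schatten.schattenClass H p, ∀ B ∈ Schatten.schattenClass H p,
      ∃ t, Schatten.HasTrace (Schatten.bracketOp p B A) t) ∧
    Schatten.IsContinuousSemiInnerProduct (Schatten.schattenClass H p) (Schatten.pNorm p)
      (Schatten.bracket p) ∧
    (∀ A ∈ Schatten.schattenClass H p, ∀ B ∈ Schatten.schattenClass H p,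
      Schatten.IsBJOrthogonal (Schatten.pNorm p) A B ↔ Schatten.bracket p B A = 0) := by
  exact ⟨fun A hA B hB => Schatten.exists_hasTrace_bracketOp hp hA hB,
    Schatten.isContinuousSemiInnerProduct_bracket hp,
    fun A hA B hB => Schatten.isBJOrthogonal_iff_bracket_eq_zero hp hA hB⟩
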